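/- Let $K\ge 2$, $n\ge 1$ and $d$ be natural numbers. For $W=[w_1,\dots,w_K]^\top\in\mathbb{R}^{K\times d}$ and $H=[h_{k,i}]_{1\le k\le K,\,1\le i\le n}\in\mathbb{R}^{d\times Kn}$ (with columns $h_{k,i}\in\mathbb{R}^d$), let $$\mathcal{L}(W,H)=-\sum_{k=1}^{K}\sum_{i=1}^{n}\log\left(\frac{\exp(w_k^\top h_{k,i})}{\sum_{j=1}^{K}\exp(w_j^\top h_{k,i})}\right)$$ be the cross-entropy loss of the unconstrained layer-peeled model (ULPM). Let $(W(t),H(t))$, $t\in[0,\infty)$, be a solution of the gradient flow $$\frac{dW}{dt}=-\frac{\partial\mathcal{L}}{\partial W}(W(t),H(t)),\qquad \frac{dH}{dt}=-\frac{\partial\mathcal{L}}{\partial H}(W(t),H(t)),$$ and suppose that $\mathcal{L}(W(t_0),H(t_0))<\log 2$ for some $t_0\ge 0$. Then every limit point, as $t\to\infty$, of the normalized trajectory $$\frac{(W(t),H(t))}{\sqrt{\|W(t)\|_F^2+\|H(t)\|_F^2}}$$ is a positive multiple of a Karush-Kuhn-Tucker (KKT) point of the minimum-norm separation problem $$\min_{W,H}\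 \tfrac12\|W\|_F^2+\tfrac12\|H\|_F^2\quad\text{subject to}\quad w_k^\top h_{k,i}-w_j^\top h_{k,i}\ge 1\quad\text{for all }k\ne j\in\{1,\dots,K\},\ i\in\{1,\dots,n\}.$$ Here a KKT point of the problem of minimizing a differentiable function $f(x)$ subject to differentiable constraints $g_l(x)\le 0$ is a feasible point $x$ for which there exist multipliers $\lambda_l\ge 0$ with $\nabla f(x)+\sum_l\lambda_l\nabla g_l(x)=0$ and $\lambda_l g_l(x)=0$ for all $l$. -/

import Mathlib

open Filter Topology Set
open scoped Gradient

noncomputable section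

namespace ULPM

/-- The parameter space of vectors `θ = vec(W, H)` for `K` classes, `n` samples per class and
feature dimension `d`, with the Euclidean inner product of all entries of `W` and `H`. -/
abbrev Params (K n d : ℕ) : Type :=
  EuclideanSpace ℝ ((Fin K × Fin d) ⊕ (Fin d × (Fin K × Fin n)))

/-- The classifier matrix `W ∈ ℝ^{K × d}` of `θ`; its `k`-th row is `w_k`. -/
def W {K n d : ℕ} (θ : Params K n d) : Matrix (Fin K) (Fin d) ℝ :=
  Matrix.of fun k a => θ (Sum.inl (k, a))

/-- The feature matrix `H ∈ ℝ^{d × Kn}` of `θ`; its column with index `(k, i)` is `h_{k,i}`. -/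
def H {K n d : ℕ} (θ : Params K n d) : Matrix (Fin d) (Fin K × Fin n) ℝ :=
  Matrix.of fun a c => θ (Sum.inr (a, c))

/-- The squared Frobenius norm of a real matrix. -/
def frobSq {m l : Type*} [Fintype m] [Fintype l] (A : Matrix m l ℝ) : ℝ :=
  ∑ r : m, ∑ c : l, A r c ^ 2

/-- The logit `w_j ⬝ h_{k,i}` of the `i`-th sample of class `k` for the label `j`. -/
def logit {K n d : ℕ} (θ : Params K n d) (j k : Fin K) (i : Fin n) : ℝ :=
  (W θ).row j ⬝ᵥ (H θ).col (k, i)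

/-- The cross-entropy loss of the unconstrained layer-peeled model. -/
def loss {K n d : ℕ} (θ : Params K n d) : ℝ :=
  -∑ k : Fin K, ∑ i : Fin n,
    Real.log (Real.exp (logit θ k k i) / ∑ j : Fin K, Real.exp (logit θ j k i))

/-- `θ : [0, ∞) → Params K n d` solves the gradient flow `θ' = -∇ L(θ)` of the loss (the derivative
at time `0` is one-sided; values at negative times play no role). -/
def IsGradientFlow {K n d : ℕ} (θ : ℝ → Params K n d) : Prop :=
  ∀ t : ℝ, 0 ≤ t → HasDerivWithinAt θ (-(∇ (loss (K := K) (n := n) (d := d)) (θ t))) (Ici 0) t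

/-- The normalized parameters `(W, H) / √(‖W‖_F² + ‖H‖_F²)`. -/
def normalized {K n d : ℕ} (θ : Params K n d) : Params K n d :=
  (Real.sqrt (frobSq (W θ) + frobSq (H θ)))⁻¹ • θ

/-- `x` is a Karush-Kuhn-Tucker point of the problem of minimizing `f` subject to `g i ≤ 0` for all
`i`, where `f` and all `g i` are differentiable. -/
def IsKKTPoint {E ι : Type*} [NormedAddCommGroup E] [InnerProductSpace ℝ E] [CompleteSpace E]
    [Fintype ι] (f : E → ℝ) (g : ι → E → ℝ) (x : E) : Prop :=
  (∀ i, g i x ≤ 0) ∧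
    ∃ μ : ι → ℝ, (∀ i, 0 ≤ μ i) ∧ ∇ f x + ∑ i, μ i • ∇ (g i) x = 0 ∧ ∀ i, μ i * g i x = 0

/-- The objective `½‖W‖_F² + ½‖H‖_F²` of the minimum-norm separation problem. -/
def sepObjective {K n d : ℕ} (θ : Params K n d) : ℝ :=
  1 / 2 * frobSq (W θ) + 1 / 2 * frobSq (H θ)

/-- The index set of the separation constraints: triples `(k, j, i)` with `k ≠ j`. -/
abbrev SepIndex (K n : ℕ) : Type :=
  {p : Fin K × Fin K × Fin n // p.1 ≠ p.2.1}

/-- The constraint `w_k ⬝ h_{k,i} - w_j ⬝ h_{k,i} ≥ 1`, in the standard form `g ≤ 0`, for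
`p = (k, j, i)`. -/
def sepConstraint {K n d : ℕ} (p : SepIndex K n) (θ : Params K n d) : ℝ :=
  1 - (logit θ p.1.1 p.1.1 p.1.2.2 - logit θ p.1.2.1 p.1.1 p.1.2.2)

/-- `(W, H)` is a KKT point of the minimum-norm separation problem: minimize `½‖W‖_F² + ½‖H‖_F²`
subject to `w_k ⬝ h_{k,i} - w_j ⬝ h_{k,i} ≥ 1` for all `k ≠ j` and all `i`. -/
def IsSepKKTPoint {K n d : ℕ} (θ : Params K n d) : Prop :=
  IsKKTPoint sepObjective (sepConstraint (K := K) (n := n) (d := d)) θ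

end ULPM

end

noncomputable section

namespace QuadraticMargin

open scoped RealInnerProductSpace

/-! ### Quadratic margins. -/

variable {E ι N : Type*} [NormedAddCommGroup E] [InnerProductSpace ℝ E]

/-! Logit differences are quadratic forms `½⟪A p θ, θ⟫`, so the loss is a logistic loss `L` of
2-homogeneous margins. Once `L < log 2`, the soft margin `-log (exp L - 1)` is positive and bounds
every margin from below.

Use `log ‖θ‖` as clock. By Euler's identity and the lower bound on margins (`le_alignment`), `log
(softMargin / ‖θ‖²)` increases at rate at least `2 * deviation²` in this clock, while the direction
moves at speed `deviation`. The first quantity is bounded above and `‖θ‖` diverges, so late clock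
windows of length one contain times of small deviation, and the direction barely moves on them.
Every limit direction is thus approached along times at which the gradient becomes radial
(`exists_direction_near_of_mapClusterPt`).

The rescaled softmax weights at these times are approximate Lagrange multipliers. They are bounded
because the normalized margins stay away from zero; a convergent subsequence gives stationarity.
Weights decay exponentially in the margin, so only minimal margins keep a nonzero multiplier, which
is complementary slackness. Rescaling the limit to minimal margin one gives the KKT point. -/

/-- The quadratic form `½⟪A p θ, θ⟫` attached to the `p`-th operator of the family `A`. -/
def margin (A : ι → E →L[ℝ] E) (p : ι) (θ : E) : ℝ := 1 / 2 * ⟪A p θ, θ⟫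

lemma margin_smul (A : ι → E →L[ℝ] E) (p : ι) (c : ℝ) (θ : E) :
    margin A p (c • θ) = c ^ 2 * margin A p θ := by
  simp only [margin, map_smul, inner_smul_left, inner_smul_right, conj_trivial]
  ring

/-- The unit vector in the direction of `θ`. -/
def direction (θ : E) : E := ‖θ‖⁻¹ • θ

lemma margin_direction (A : ι → E →L[ℝ] E) (p : ι) (θ : E) :
    margin A p (direction θ) = margin A p θ / ‖θ‖ ^ 2 := by
  rw [direction, margin_smul, inv_pow, div_eq_inv_mul]

lemma continuous_margin (A : ι → E →L[ℝ] E) (p : ι) : Continuous (margin A p) := by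
  unfold margin
  fun_prop

lemma margin_le (A : ι → E →L[ℝ] E) (p : ι) (θ : E) :
    margin A p θ ≤ 1 / 2 * ‖A p‖ * ‖θ‖ ^ 2 := by
  have h1 := real_inner_le_norm (A p θ) θ
  have h2 := mul_le_mul_of_nonneg_right ((A p).le_opNorm θ) (norm_nonneg θ)
  unfold margin
  nlinarith

lemma hasFDerivAt_margin {A : ι → E →L[ℝ] E} (hA : ∀ p x y, ⟪A p x, y⟫ = ⟪x, A p y⟫)
    (p : ι) (θ : E) : HasFDerivAt (margin A p) (innerSL ℝ (A p θ)) θ := by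
  have h := (((A p).hasFDerivAt (x := θ)).inner ℝ (hasFDerivAt_id θ)).const_mul (1 / 2 : ℝ)
  refine h.congr_fderiv ?_
  ext x
  simp [hA p x θ, real_inner_comm x (A p θ)]
  ring

/-! ### Logistic loss, soft margin and alignment. -/

variable [Fintype ι] [DecidableEq N]

/-- The sum of `exp (-margin)` over all margins belonging to the sample `m`. -/
def expSum (A : ι → E →L[ℝ] E) (s : ι → N) (m : N) (θ : E) : ℝ :=
  ∑ p with s p = m, Real.exp (-margin A p θ)

/-- The weight of the `p`-th margin in the gradient of the logistic loss. -/
def weight (A : ι → E →L[ℝ] E) (s : ι → N) (p : ι) (θ : E) : ℝ :=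
  Real.exp (-margin A p θ) / (1 + expSum A s (s p) θ)

/-- The negative gradient of the logistic loss. -/
def descent (A : ι → E →L[ℝ] E) (s : ι → N) (θ : E) : E := ∑ p, weight A s p θ • A p θ

/-- The inner product of `θ` with the negative gradient of the logistic loss. -/
def alignment (A : ι → E →L[ℝ] E) (s : ι → N) (θ : E) : ℝ := ⟪θ, descent A s θ⟫

/-- The tangent of the angle between `θ` and the negative gradient of the loss, as the length of
the rescaled tangential part of the latter. -/
def deviation (A : ι → E →L[ℝ] E) (s : ι → N) (θ : E) : ℝ :=
  ‖(‖θ‖ / alignment A s θ) • descent A s θ - direction θ‖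

variable (A : ι → E →L[ℝ] E) (s : ι → N)

lemma expSum_nonneg (m : N) (θ : E) : 0 ≤ expSum A s m θ :=
  Finset.sum_nonneg fun _ _ => (Real.exp_pos _).le

lemma weight_pos (p : ι) (θ : E) : 0 < weight A s p θ :=
  div_pos (Real.exp_pos _) (by linarith [expSum_nonneg A s (s p) θ])

lemma exp_neg_margin_le_expSum (p : ι) (θ : E) :
    Real.exp (-margin A p θ) ≤ expSum A s (s p) θ :=
  Finset.single_le_sum (f := fun p => Real.exp (-margin A p θ))
    (fun _ _ => (Real.exp_pos _).le) (by simp)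

lemma alignment_eq (θ : E) :
    alignment A s θ = 2 * ∑ p, weight A s p θ * margin A p θ := by
  rw [alignment, descent, inner_sum, Finset.mul_sum]
  refine Finset.sum_congr rfl fun p _ => ?_
  rw [inner_smul_right, real_inner_comm, margin]
  ring

/-- Pythagoras: the factor `‖θ‖ / alignment` makes the radial part of the rescaled descent vector
equal to the unit direction. -/
lemma deviation_sq {θ : E} (hθ : θ ≠ 0)
    (hν : alignment A s θ ≠ 0) :
    deviation A s θ ^ 2 = ‖θ‖ ^ 2 * ‖descent A s θ‖ ^ 2 / alignment A s θ ^ 2 - 1 := by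
  have hρ : ‖θ‖ ≠ 0 := norm_ne_zero_iff.2 hθ
  have h1 : ‖direction θ‖ = 1 := by
    rw [direction, norm_smul, norm_inv, norm_norm, inv_mul_cancel₀ hρ]
  have h2 : ⟪descent A s θ, θ⟫ = alignment A s θ := real_inner_comm _ _
  rw [deviation, norm_sub_sq_real, h1, norm_smul, direction, inner_smul_left, inner_smul_right, h2,
    mul_pow, Real.norm_eq_abs, sq_abs, conj_trivial]
  field_simp
  ring

variable [Fintype N]

/-- The logistic loss `∑ₘ log (1 + ∑ₚ exp (-margin))`. -/
def logisticLoss (A : ι → E →L[ℝ] E) (s : ι → N) (θ : E) : ℝ :=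
  ∑ m, Real.log (1 + expSum A s m θ)

/-- The smooth lower bound `-log (exp L - 1)` of all margins. -/
def softMargin (A : ι → E →L[ℝ] E) (s : ι → N) (θ : E) : ℝ :=
  -Real.log (Real.exp (logisticLoss A s θ) - 1)

lemma exp_logisticLoss (θ : E) :
    Real.exp (logisticLoss A s θ) = ∏ m, (1 + expSum A s m θ) := by
  rw [logisticLoss, Real.exp_sum]
  exact Finset.prod_congr rfl fun m _ => Real.exp_log (by linarith [expSum_nonneg A s m θ])

lemma expSum_le (m : N) (θ : E) : 1 + expSum A s m θ ≤ Real.exp (logisticLoss A s θ) := by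
  rw [← Real.log_le_iff_le_exp (by linarith [expSum_nonneg A s m θ])]
  exact Finset.single_le_sum (f := fun m => Real.log (1 + expSum A s m θ))
    (fun m _ => Real.log_nonneg (by linarith [expSum_nonneg A s m θ])) (Finset.mem_univ m)

lemma exp_neg_margin_le (p : ι) (θ : E) :
    Real.exp (-margin A p θ) ≤ Real.exp (logisticLoss A s θ) - 1 := by
  linarith [exp_neg_margin_le_expSum A s p θ, expSum_le A s (s p) θ]

lemma exp_logisticLoss_sub_one_pos [Nonempty ι] (θ : E) :
    0 < Real.exp (logisticLoss A s θ) - 1 := by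
  obtain ⟨p⟩ := ‹Nonempty ι›
  exact (Real.exp_pos _).trans_le (exp_neg_margin_le A s p θ)

lemma softMargin_le_margin (p : ι) (θ : E) : softMargin A s θ ≤ margin A p θ := by
  have h := Real.log_le_log (Real.exp_pos _) (exp_neg_margin_le A s p θ)
  rw [Real.log_exp] at h
  unfold softMargin
  linarith

lemma softMargin_pos [Nonempty ι] {θ : E} (h : logisticLoss A s θ < Real.log 2) :
    0 < softMargin A s θ := by
  have h1 := exp_logisticLoss_sub_one_pos A s θ
  have h2 : Real.exp (logisticLoss A s θ) < 2 := by
    rwa [← Real.lt_log_iff_exp_lt (by norm_num)]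
  have := Real.log_neg h1 (by linarith)
  unfold softMargin
  linarith

lemma expSum_lt_one {θ : E} (h : logisticLoss A s θ < Real.log 2) (m : N) :
    expSum A s m θ < 1 := by
  have h2 : Real.exp (logisticLoss A s θ) < 2 := by
    rwa [← Real.lt_log_iff_exp_lt (by norm_num)]
  linarith [expSum_le A s m θ]

lemma one_sub_prod_le_sum {α : Type*} (S : Finset α) (f : α → ℝ) (h0 : ∀ a, 0 ≤ f a)
    (h1 : ∀ a, f a ≤ 1) : 1 - ∏ a ∈ S, (1 - f a) ≤ ∑ a ∈ S, f a := by
  classical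
  induction S using Finset.induction_on with
  | empty => simp
  | insert a S ha ih =>
    rw [Finset.prod_insert ha, Finset.sum_insert ha]
    have : ∏ a ∈ S, (1 - f a) ≤ 1 :=
      Finset.prod_le_one (fun b _ => by linarith [h1 b]) (fun b _ => by linarith [h0 b])
    nlinarith [h0 a]

lemma sum_weight (θ : E) :
    ∑ p, weight A s p θ = ∑ m, expSum A s m θ / (1 + expSum A s m θ) := by
  rw [← Finset.sum_fiberwise Finset.univ s]
  refine Finset.sum_congr rfl fun m _ => ?_
  rw [expSum, Finset.sum_div]
  refine Finset.sum_congr rfl fun p hp => ?_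
  have : s p = m := by simpa using hp
  rw [weight, this, expSum]

/-- With `u m = x m / (1 + x m)`, where `x m` is the exponential sum of sample `m`, one has `exp
(-L) = ∏ (1 - u m)` and the weights sum to `∑ u m`, so this is the union bound. -/
lemma one_sub_exp_neg_logisticLoss_le (θ : E) :
    1 - Real.exp (-logisticLoss A s θ) ≤ ∑ p, weight A s p θ := by
  have hpos : ∀ m, 0 < 1 + expSum A s m θ := fun m => by linarith [expSum_nonneg A s m θ]
  rw [sum_weight, Real.exp_neg, exp_logisticLoss, ← Finset.prod_inv_distrib]
  refine le_trans (le_of_eq ?_) (one_sub_prod_le_sum Finset.univ _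
    (fun m => div_nonneg (expSum_nonneg A s m θ) (hpos m).le)
    (fun m => (div_le_one (hpos m)).2 (by linarith)))
  congr 1
  refine Finset.prod_congr rfl fun m _ => ?_
  field_simp [(hpos m).ne']
  ring

/-- Euler's identity writes the alignment as twice the weighted sum of margins. The factor `1 - exp
(-L)` is the one in the logarithmic derivative of the soft margin, so this bound yields
monotonicity. -/
lemma le_alignment {θ : E} (h : 0 ≤ softMargin A s θ) :
    2 * (softMargin A s θ * (1 - Real.exp (-logisticLoss A s θ))) ≤ alignment A s θ := by
  rw [alignment_eq]
  have h1 : softMargin A s θ * (1 - Real.exp (-logisticLoss A s θ)) ≤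
      ∑ p, weight A s p θ * margin A p θ := by
    refine (mul_le_mul_of_nonneg_left (one_sub_exp_neg_logisticLoss_le A s θ) h).trans ?_
    rw [Finset.mul_sum]
    refine Finset.sum_le_sum fun p _ => ?_
    rw [mul_comm]
    exact mul_le_mul_of_nonneg_left (softMargin_le_margin A s p θ) (weight_pos A s p θ).le
  linarith

lemma logisticLoss_pos [Nonempty ι] (θ : E) : 0 < logisticLoss A s θ := by
  have := exp_logisticLoss_sub_one_pos A s θ
  rw [← Real.exp_lt_exp, Real.exp_zero]
  linarith

lemma alignment_pos [Nonempty ι] {θ : E} (h : logisticLoss A s θ < Real.log 2) :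
    0 < alignment A s θ := by
  have h1 := softMargin_pos A s h
  have h2 : Real.exp (-logisticLoss A s θ) < 1 := by
    rw [Real.exp_lt_one_iff]; linarith [logisticLoss_pos A s θ]
  have h3 : 0 < 1 - Real.exp (-logisticLoss A s θ) := by linarith
  have := le_alignment A s h1.le
  have := mul_pos h1 h3
  linarith

lemma ne_zero_of_logisticLoss_lt [Nonempty ι] {θ : E} (h : logisticLoss A s θ < Real.log 2) :
    θ ≠ 0 := by
  rintro rfl
  simpa [alignment] using alignment_pos A s h

variable {A}

lemma hasFDerivAt_logisticLoss (hA : ∀ p x y, ⟪A p x, y⟫ = ⟪x, A p y⟫) (θ : E) :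
    HasFDerivAt (logisticLoss A s) (innerSL ℝ (-descent A s θ)) θ := by
  have hx : ∀ m, HasFDerivAt (expSum A s m)
      (∑ p with s p = m, Real.exp (-margin A p θ) • -innerSL ℝ (A p θ)) θ := fun m =>
    HasFDerivAt.fun_sum fun p _ => ((hasFDerivAt_margin hA p θ).neg).exp
  have hl : HasFDerivAt (logisticLoss A s) (∑ m, (1 + expSum A s m θ)⁻¹ •
      ∑ p with s p = m, Real.exp (-margin A p θ) • -innerSL ℝ (A p θ)) θ :=
    HasFDerivAt.fun_sum fun m _ =>
      ((hx m).const_add 1).log (by linarith [expSum_nonneg A s m θ])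
  refine hl.congr_fderiv ?_
  rw [descent, ← Finset.sum_neg_distrib, map_sum, ← Finset.sum_fiberwise Finset.univ s]
  refine Finset.sum_congr rfl fun m _ => ?_
  rw [Finset.smul_sum]
  refine Finset.sum_congr rfl fun p hp => ?_
  have : s p = m := by simpa using hp
  rw [weight, this, smul_smul, map_neg, map_smul, smul_neg, div_eq_inv_mul]

/-! ### Comparison of increments by derivatives. -/

lemma norm_sub_le_sub_of_hasDerivWithinAt {F : Type*} [NormedAddCommGroup F] [NormedSpace ℝ F]
    {f f' : ℝ → F} {g g' : ℝ → ℝ} {t₀ a b : ℝ} (h₀ : t₀ ≤ a) (hab : a ≤ b)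
    (hf : ∀ t, t₀ ≤ t → HasDerivWithinAt f (f' t) (Ici t₀) t)
    (hg : ∀ t, t₀ ≤ t → HasDerivWithinAt g (g' t) (Ici t₀) t)
    (h : ∀ t, a ≤ t → t ≤ b → ‖f' t‖ ≤ g' t) : ‖f b - f a‖ ≤ g b - g a := by
  have hsub : Icc a b ⊆ Ici t₀ := fun t ht => h₀.trans ht.1
  refine image_norm_le_of_norm_deriv_right_le_deriv_boundary' (f := fun t => f t - f a)
    (B := fun t => g t - g a) (f' := f') (B' := g') ?_ ?_ (by simp) ?_ ?_ ?_ (right_mem_Icc.2 hab)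
  · exact fun t ht => (((hf t (hsub ht)).continuousWithinAt).mono hsub).sub
      continuousWithinAt_const
  · exact fun t ht => ((hf t (h₀.trans ht.1)).mono
      (Ici_subset_Ici.2 (h₀.trans ht.1))).sub_const _
  · exact fun t ht => (((hg t (hsub ht)).continuousWithinAt).mono hsub).sub
      continuousWithinAt_const
  · exact fun t ht => ((hg t (h₀.trans ht.1)).mono
      (Ici_subset_Ici.2 (h₀.trans ht.1))).sub_const _
  · exact fun t ht => h t ht.1 ht.2.le

lemma sub_le_sub_of_hasDerivWithinAt {f f' g g' : ℝ → ℝ} {t₀ a b : ℝ} (h₀ : t₀ ≤ a) (hab : a ≤ b)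
    (hf : ∀ t, t₀ ≤ t → HasDerivWithinAt f (f' t) (Ici t₀) t)
    (hg : ∀ t, t₀ ≤ t → HasDerivWithinAt g (g' t) (Ici t₀) t)
    (h : ∀ t, a ≤ t → t ≤ b → f' t ≤ g' t) : f b - f a ≤ g b - g a := by
  have := norm_sub_le_sub_of_hasDerivWithinAt (f := fun _ => (0 : ℝ)) (f' := fun _ => 0)
    (g := fun t => g t - f t) (g' := fun t => g' t - f' t) h₀ hab
    (fun t _ => hasDerivWithinAt_const _ _ _) (fun t ht => (hg t ht).sub (hf t ht))
    (fun t h1 h2 => by simpa using h t h1 h2)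
  simp only [sub_self, norm_zero] at this
  linarith

/-- The logarithm of the normalized soft margin. -/
def logSoftMargin (A : ι → E →L[ℝ] E) (s : ι → N) (θ : E) : ℝ :=
  Real.log (softMargin A s θ) - 2 * Real.log ‖θ‖

/-! ### Gradient flow in the clock `log ‖θ‖`. -/

section Flow

variable {A : ι → E →L[ℝ] E} {s : ι → N} {θ : ℝ → E} {t₀ : ℝ}

lemma hasDerivWithinAt_loss (hA : ∀ p x y, ⟪A p x, y⟫ = ⟪x, A p y⟫)
    (hθ : ∀ t, t₀ ≤ t → HasDerivWithinAt θ (descent A s (θ t)) (Ici t₀) t) {t : ℝ} (ht : t₀ ≤ t) :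
    HasDerivWithinAt (fun t => logisticLoss A s (θ t)) (-‖descent A s (θ t)‖ ^ 2) (Ici t₀) t := by
  have h := (hasFDerivAt_logisticLoss s hA (θ t)).comp_hasDerivWithinAt t (hθ t ht)
  refine h.congr_deriv ?_
  simp

lemma logisticLoss_le (hA : ∀ p x y, ⟪A p x, y⟫ = ⟪x, A p y⟫)
    (hθ : ∀ t, t₀ ≤ t → HasDerivWithinAt θ (descent A s (θ t)) (Ici t₀) t) {t : ℝ} (ht : t₀ ≤ t) :
    logisticLoss A s (θ t) ≤ logisticLoss A s (θ t₀) := by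
  have := sub_le_sub_of_hasDerivWithinAt (g := fun _ => (0 : ℝ)) (g' := fun _ => 0) le_rfl ht
    (fun t ht => hasDerivWithinAt_loss hA hθ ht) (fun t _ => hasDerivWithinAt_const _ _ _)
    (fun t _ _ => by simp)
  linarith

variable [Nonempty ι]

lemma hasDerivWithinAt_norm
    (hθ : ∀ t, t₀ ≤ t → HasDerivWithinAt θ (descent A s (θ t)) (Ici t₀) t)
    (hL : ∀ t, t₀ ≤ t → logisticLoss A s (θ t) < Real.log 2) {t : ℝ} (ht : t₀ ≤ t) :
    HasDerivWithinAt (fun t => ‖θ t‖) (alignment A s (θ t) / ‖θ t‖) (Ici t₀) t := by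
  have h0 : ‖θ t‖ ≠ 0 := norm_ne_zero_iff.2 (ne_zero_of_logisticLoss_lt A s (hL t ht))
  have h := (hθ t ht).norm_sq.sqrt (pow_ne_zero 2 h0)
  simp only [Real.sqrt_sq (norm_nonneg _)] at h
  refine h.congr_deriv ?_
  rw [alignment]
  field_simp

lemma hasDerivWithinAt_log_norm
    (hθ : ∀ t, t₀ ≤ t → HasDerivWithinAt θ (descent A s (θ t)) (Ici t₀) t)
    (hL : ∀ t, t₀ ≤ t → logisticLoss A s (θ t) < Real.log 2) {t : ℝ} (ht : t₀ ≤ t) :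
    HasDerivWithinAt (fun t => Real.log ‖θ t‖) (alignment A s (θ t) / ‖θ t‖ ^ 2) (Ici t₀) t := by
  have h0 : ‖θ t‖ ≠ 0 := norm_ne_zero_iff.2 (ne_zero_of_logisticLoss_lt A s (hL t ht))
  refine ((hasDerivWithinAt_norm hθ hL ht).log h0).congr_deriv ?_
  field_simp

/-- The scalar factor is the derivative of `log ‖θ‖` and the vector has norm `deviation`: this is
the speed of the direction in the logarithmic clock. -/
lemma hasDerivWithinAt_direction
    (hθ : ∀ t, t₀ ≤ t → HasDerivWithinAt θ (descent A s (θ t)) (Ici t₀) t)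
    (hL : ∀ t, t₀ ≤ t → logisticLoss A s (θ t) < Real.log 2) {t : ℝ} (ht : t₀ ≤ t) :
    HasDerivWithinAt (fun t => direction (θ t)) ((alignment A s (θ t) / ‖θ t‖ ^ 2) •
      ((‖θ t‖ / alignment A s (θ t)) • descent A s (θ t) - direction (θ t))) (Ici t₀) t := by
  have h0 : ‖θ t‖ ≠ 0 := norm_ne_zero_iff.2 (ne_zero_of_logisticLoss_lt A s (hL t ht))
  have hν := (alignment_pos A s (hL t ht)).ne'
  refine (((hasDerivWithinAt_norm hθ hL ht).inv h0).smul (hθ t ht)).congr_deriv ?_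
  rw [direction, smul_sub, smul_smul, smul_smul, sub_eq_add_neg, ← neg_smul]
  congr 2
  · field_simp
    exact inv_mul_cancel₀ h0
  · field_simp

lemma hasDerivWithinAt_logSoftMargin (hA : ∀ p x y, ⟪A p x, y⟫ = ⟪x, A p y⟫)
    (hθ : ∀ t, t₀ ≤ t → HasDerivWithinAt θ (descent A s (θ t)) (Ici t₀) t)
    (hL : ∀ t, t₀ ≤ t → logisticLoss A s (θ t) < Real.log 2) {t : ℝ} (ht : t₀ ≤ t) :
    HasDerivWithinAt (fun t => logSoftMargin A s (θ t))
      (‖descent A s (θ t)‖ ^ 2 /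
          (softMargin A s (θ t) * (1 - Real.exp (-logisticLoss A s (θ t)))) -
        2 * (alignment A s (θ t) / ‖θ t‖ ^ 2)) (Ici t₀) t := by
  have hG := softMargin_pos A s (hL t ht)
  have hM := exp_logisticLoss_sub_one_pos A s (θ t)
  have h1 := ((((hasDerivWithinAt_loss hA hθ ht).exp).sub_const 1).log hM.ne').neg.log hG.ne'
  refine (h1.sub ((hasDerivWithinAt_log_norm hθ hL ht).const_mul 2)).congr_deriv ?_
  congr 1
  change _ / softMargin A s (θ t) = _
  have he := Real.exp_pos (logisticLoss A s (θ t))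
  have : 1 - Real.exp (-logisticLoss A s (θ t)) =
      (Real.exp (logisticLoss A s (θ t)) - 1) / Real.exp (logisticLoss A s (θ t)) := by
    rw [Real.exp_neg]; field_simp
  rw [this]
  field_simp

/-- Replacing the denominator by the larger `alignment / 2` (from `le_alignment`) turns the
derivative of `logSoftMargin` into the Cauchy–Schwarz defect measured by `deviation_sq`. -/
lemma deviation_le_deriv {x : E} (hL : logisticLoss A s x < Real.log 2) :
    2 * deviation A s x ^ 2 * (alignment A s x / ‖x‖ ^ 2) ≤
      ‖descent A s x‖ ^ 2 / (softMargin A s x * (1 - Real.exp (-logisticLoss A s x))) -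
        2 * (alignment A s x / ‖x‖ ^ 2) := by
  have h0 := ne_zero_of_logisticLoss_lt A s hL
  have hρ : ‖x‖ ≠ 0 := norm_ne_zero_iff.2 h0
  have hν := alignment_pos A s hL
  have hG := softMargin_pos A s hL
  have hE : 0 < 1 - Real.exp (-logisticLoss A s x) := by
    have : Real.exp (-logisticLoss A s x) < 1 := by
      rw [Real.exp_lt_one_iff]; linarith [logisticLoss_pos A s x]
    linarith
  have hle := le_alignment A s hG.le
  rw [deviation_sq A s h0 hν.ne']
  have h1 : 2 * (‖x‖ ^ 2 * ‖descent A s x‖ ^ 2 / alignment A s x ^ 2 - 1) *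
      (alignment A s x / ‖x‖ ^ 2) =
      ‖descent A s x‖ ^ 2 / (alignment A s x / 2) - 2 * (alignment A s x / ‖x‖ ^ 2) := by
    field_simp
  rw [h1]
  refine sub_le_sub_right (div_le_div_of_nonneg_left (sq_nonneg _) (mul_pos hG hE) ?_) _
  linarith

lemma log_norm_mono
    (hθ : ∀ t, t₀ ≤ t → HasDerivWithinAt θ (descent A s (θ t)) (Ici t₀) t)
    (hL : ∀ t, t₀ ≤ t → logisticLoss A s (θ t) < Real.log 2) {a b : ℝ} (ha : t₀ ≤ a)
    (hab : a ≤ b) : Real.log ‖θ a‖ ≤ Real.log ‖θ b‖ := by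
  have := sub_le_sub_of_hasDerivWithinAt (f := fun _ => (0 : ℝ)) (f' := fun _ => 0) ha hab
    (fun t _ => hasDerivWithinAt_const _ _ _) (fun t ht => hasDerivWithinAt_log_norm hθ hL ht)
    (fun t h1 _ => div_nonneg (alignment_pos A s (hL t (ha.trans h1))).le (sq_nonneg _))
  linarith

lemma norm_mono
    (hθ : ∀ t, t₀ ≤ t → HasDerivWithinAt θ (descent A s (θ t)) (Ici t₀) t)
    (hL : ∀ t, t₀ ≤ t → logisticLoss A s (θ t) < Real.log 2) {a b : ℝ} (ha : t₀ ≤ a)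
    (hab : a ≤ b) : ‖θ a‖ ≤ ‖θ b‖ :=
  (Real.log_le_log_iff (norm_pos_iff.2 (ne_zero_of_logisticLoss_lt A s (hL a ha)))
    (norm_pos_iff.2 (ne_zero_of_logisticLoss_lt A s (hL b (ha.trans hab))))).1
    (log_norm_mono hθ hL ha hab)

lemma deviation_mul_le_logSoftMargin_sub (hA : ∀ p x y, ⟪A p x, y⟫ = ⟪x, A p y⟫)
    (hθ : ∀ t, t₀ ≤ t → HasDerivWithinAt θ (descent A s (θ t)) (Ici t₀) t)
    (hL : ∀ t, t₀ ≤ t → logisticLoss A s (θ t) < Real.log 2) {a b η : ℝ} (ha : t₀ ≤ a)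
    (hab : a ≤ b) (hη : ∀ t, a ≤ t → t ≤ b → η ≤ 2 * deviation A s (θ t) ^ 2) :
    η * (Real.log ‖θ b‖ - Real.log ‖θ a‖) ≤
      logSoftMargin A s (θ b) - logSoftMargin A s (θ a) := by
  have := sub_le_sub_of_hasDerivWithinAt ha hab
    (fun t ht => (hasDerivWithinAt_log_norm hθ hL ht).const_mul η)
    (fun t ht => hasDerivWithinAt_logSoftMargin hA hθ hL ht)
    (fun t h1 h2 => (mul_le_mul_of_nonneg_right (hη t h1 h2)
      (div_nonneg (alignment_pos A s (hL t (ha.trans h1))).le (sq_nonneg _))).trans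
      (deviation_le_deriv (hL t (ha.trans h1))))
  linarith

lemma logSoftMargin_mono (hA : ∀ p x y, ⟪A p x, y⟫ = ⟪x, A p y⟫)
    (hθ : ∀ t, t₀ ≤ t → HasDerivWithinAt θ (descent A s (θ t)) (Ici t₀) t)
    (hL : ∀ t, t₀ ≤ t → logisticLoss A s (θ t) < Real.log 2) {a b : ℝ} (ha : t₀ ≤ a)
    (hab : a ≤ b) : logSoftMargin A s (θ a) ≤ logSoftMargin A s (θ b) := by
  have := deviation_mul_le_logSoftMargin_sub (η := 0) hA hθ hL ha hab
    (fun t _ _ => by positivity)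
  linarith

lemma norm_direction_sub_le (hA : ∀ p x y, ⟪A p x, y⟫ = ⟪x, A p y⟫)
    (hθ : ∀ t, t₀ ≤ t → HasDerivWithinAt θ (descent A s (θ t)) (Ici t₀) t)
    (hL : ∀ t, t₀ ≤ t → logisticLoss A s (θ t) < Real.log 2) {a b δ : ℝ} (ha : t₀ ≤ a)
    (hab : a ≤ b) (hδ : 0 < δ) :
    ‖direction (θ b) - direction (θ a)‖ ≤ δ / 2 * (Real.log ‖θ b‖ - Real.log ‖θ a‖) +
      (4 * δ)⁻¹ * (logSoftMargin A s (θ b) - logSoftMargin A s (θ a)) := by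
  have := norm_sub_le_sub_of_hasDerivWithinAt ha hab
    (fun t ht => hasDerivWithinAt_direction hθ hL ht)
    (fun t ht => ((hasDerivWithinAt_log_norm hθ hL ht).const_mul (δ / 2)).add
      ((hasDerivWithinAt_logSoftMargin hA hθ hL ht).const_mul (4 * δ)⁻¹))
    (fun t h1 h2 => ?_)
  · simp only [Pi.add_apply] at this
    linarith
  · have hr : 0 ≤ alignment A s (θ t) / ‖θ t‖ ^ 2 :=
      div_nonneg (alignment_pos A s (hL t (ha.trans h1))).le (sq_nonneg _)
    have hd := mul_le_mul_of_nonneg_left (deviation_le_deriv (hL t (ha.trans h1)))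
      (inv_pos.2 (by positivity : 0 < 4 * δ)).le
    rw [norm_smul, Real.norm_of_nonneg hr]
    change _ * deviation A s (θ t) ≤ _
    refine le_trans ?_ (add_le_add_right hd _)
    -- Young's inequality `r ≤ δ/2 + r²/(2δ)` trades the speed for the two controlled rates.
    have hq : deviation A s (θ t) ≤ δ / 2 + (4 * δ)⁻¹ * (2 * deviation A s (θ t) ^ 2) := by
      have : 0 ≤ (δ - deviation A s (θ t)) ^ 2 / (2 * δ) := by positivity
      have e : (δ - deviation A s (θ t)) ^ 2 / (2 * δ) =
        δ / 2 + (4 * δ)⁻¹ * (2 * deviation A s (θ t) ^ 2) - deviation A s (θ t) := by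
        field_simp
        ring
      linarith
    nlinarith [mul_le_mul_of_nonneg_left hq hr]

/-- Under the flow the norm of the parameters diverges. -/
lemma tendsto_norm_atTop (hA : ∀ p x y, ⟪A p x, y⟫ = ⟪x, A p y⟫)
    (hθ : ∀ t, t₀ ≤ t → HasDerivWithinAt θ (descent A s (θ t)) (Ici t₀) t)
    (hL : ∀ t, t₀ ≤ t → logisticLoss A s (θ t) < Real.log 2) :
    Tendsto (fun t => ‖θ t‖) atTop atTop := by
  refine tendsto_atTop.2 fun M => ?_
  suffices h : ∃ b, t₀ ≤ b ∧ M ≤ ‖θ b‖ by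
    obtain ⟨b, hb, hM⟩ := h
    filter_upwards [eventually_ge_atTop b] with t ht
    exact hM.trans (norm_mono hθ hL hb ht)
  by_contra! hM
  obtain ⟨p⟩ : Nonempty ι := inferInstance
  set Q : ℝ := 1 / 2 * ‖A p‖ * M ^ 2
  have hloss : ∀ t, t₀ ≤ t → 1 + Real.exp (-Q) ≤ Real.exp (logisticLoss A s (θ t)) := by
    intro t ht
    have h1 : margin A p (θ t) ≤ Q := (margin_le A p (θ t)).trans
      (mul_le_mul_of_nonneg_left (pow_le_pow_left₀ (norm_nonneg _) (hM t ht).le 2) (by positivity))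
    have h2 := Real.exp_le_exp.2 (neg_le_neg h1)
    linarith [exp_neg_margin_le A s p (θ t)]
  -- A bounded norm keeps the loss away from zero, hence the alignment above `c`; then `‖θ‖²` grows
  -- at least linearly, which contradicts the bound at time `t₀ + M²/c`.
  set c : ℝ := 2 * (softMargin A s (θ t₀) * (1 - (1 + Real.exp (-Q))⁻¹))
  have hinv : (1 + Real.exp (-Q))⁻¹ < 1 := inv_lt_one_of_one_lt₀ (by linarith [Real.exp_pos (-Q)])
  have hG₀ := softMargin_pos A s (hL t₀ le_rfl)
  have hcpos : 0 < c := mul_pos two_pos (mul_pos hG₀ (by linarith))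
  have hν : ∀ t, t₀ ≤ t → c ≤ alignment A s (θ t) := by
    intro t ht
    refine le_trans ?_ (le_alignment A s (softMargin_pos A s (hL t ht)).le)
    have hG : softMargin A s (θ t₀) ≤ softMargin A s (θ t) := by
      have := Real.log_le_log (exp_logisticLoss_sub_one_pos A s (θ t))
        (sub_le_sub_right (Real.exp_le_exp.2 (logisticLoss_le hA hθ ht)) 1)
      exact neg_le_neg this
    have hE : Real.exp (-logisticLoss A s (θ t)) ≤ (1 + Real.exp (-Q))⁻¹ := by
      rw [Real.exp_neg]
      exact inv_anti₀ (by linarith [Real.exp_pos (-Q)]) (hloss t ht)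
    have := mul_le_mul hG (sub_le_sub_left hE 1) (by linarith)
      (softMargin_pos A s (hL t ht)).le
    linarith
  have hgrow : ∀ t, t₀ ≤ t → c * (t - t₀) ≤ ‖θ t‖ ^ 2 := by
    intro t ht
    have := sub_le_sub_of_hasDerivWithinAt (f := fun t => c * t) (f' := fun _ => c * 1) le_rfl ht
      (fun t _ => (hasDerivWithinAt_id _ _).const_mul c) (fun t ht => (hθ t ht).norm_sq)
      (fun t h1 _ => by
        have := hν t h1
        rw [alignment] at this
        linarith)
    nlinarith [sq_nonneg ‖θ t₀‖]
  have hM0 : 0 ≤ M := (norm_nonneg _).trans (hM t₀ le_rfl).le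
  have ht : t₀ ≤ t₀ + M ^ 2 / c := by
    have : 0 ≤ M ^ 2 / c := by positivity
    linarith
  have h1 := hgrow _ ht
  have h2 := pow_lt_pow_left₀ (hM _ ht) (norm_nonneg _) two_ne_zero
  have h3 : c * (t₀ + M ^ 2 / c - t₀) = M ^ 2 := by field_simp; ring
  linarith

lemma logSoftMargin_le {x : E} (p : ι) (hL : logisticLoss A s x < Real.log 2) :
    logSoftMargin A s x ≤ Real.log (1 / 2 * ‖A p‖) := by
  have hx := norm_pos_iff.2 (ne_zero_of_logisticLoss_lt A s hL)
  have hG := softMargin_pos A s hL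
  have h1 := (softMargin_le_margin A s p x).trans (margin_le A p x)
  have hB : 0 < 1 / 2 * ‖A p‖ := by
    by_contra! h
    nlinarith [sq_nonneg ‖x‖]
  have := Real.log_le_log hG h1
  rw [Real.log_mul hB.ne' (by positivity), Real.log_pow] at this
  push_cast at this
  unfold logSoftMargin
  linarith

/-- A bounded monotone function has arbitrarily small increments at late times. -/
lemma exists_logSoftMargin_sub_lt (hA : ∀ p x y, ⟪A p x, y⟫ = ⟪x, A p y⟫)
    (hθ : ∀ t, t₀ ≤ t → HasDerivWithinAt θ (descent A s (θ t)) (Ici t₀) t)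
    (hL : ∀ t, t₀ ≤ t → logisticLoss A s (θ t) < Real.log 2) {η : ℝ} (hη : 0 < η) :
    ∃ T, t₀ ≤ T ∧ ∀ a b, T ≤ a → a ≤ b →
      logSoftMargin A s (θ b) - logSoftMargin A s (θ a) < η := by
  obtain ⟨p⟩ : Nonempty ι := inferInstance
  have hbdd : BddAbove ((fun t => logSoftMargin A s (θ t)) '' Ici t₀) := by
    refine ⟨Real.log (1 / 2 * ‖A p‖), ?_⟩
    rintro _ ⟨t, ht, rfl⟩
    exact logSoftMargin_le p (hL t ht)
  obtain ⟨_, ⟨T, hT, rfl⟩, hlt⟩ := exists_lt_of_lt_csSup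
    ((nonempty_Ici (a := t₀)).image fun t => logSoftMargin A s (θ t))
    (sub_lt_self (sSup ((fun t => logSoftMargin A s (θ t)) '' Ici t₀)) hη)
  refine ⟨T, hT, fun a b ha hab => ?_⟩
  have h1 := logSoftMargin_mono hA hθ hL hT ha
  have h2 := le_csSup hbdd (mem_image_of_mem (fun t => logSoftMargin A s (θ t))
    (show b ∈ Ici t₀ from (le_trans hT ha).trans hab))
  simp only at hlt h2
  linarith

/-- Near every limit direction there are arbitrarily late times at which the flow is almost
radial. -/
lemma exists_direction_near_of_mapClusterPt (hA : ∀ p x y, ⟪A p x, y⟫ = ⟪x, A p y⟫)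
    (hθ : ∀ t, t₀ ≤ t → HasDerivWithinAt θ (descent A s (θ t)) (Ici t₀) t)
    (hL : ∀ t, t₀ ≤ t → logisticLoss A s (θ t) < Real.log 2) {z : E}
    (hz : MapClusterPt z atTop fun t => direction (θ t)) {ε : ℝ} (hε : 0 < ε) (T : ℝ) :
    ∃ t, T ≤ t ∧ t₀ ≤ t ∧ ‖direction (θ t) - z‖ < ε ∧ deviation A s (θ t) < ε := by
  -- The increment `ε²/2` both forces `deviation < ε` somewhere in a unit window and, with `δ =
  -- ε/2`, limits the motion of the direction to `ε/4 + ε/4`.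
  obtain ⟨T', hT', hΓ⟩ := exists_logSoftMargin_sub_lt hA hθ hL (by positivity : 0 < ε ^ 2 / 2)
  have hfr := hz.frequently (Metric.ball_mem_nhds z (half_pos hε))
  obtain ⟨a, haz, haT, haT'⟩ :=
    (hfr.and_eventually ((eventually_ge_atTop T).and (eventually_ge_atTop T'))).exists
  have ha : t₀ ≤ a := hT'.trans haT'
  have hlog := Real.tendsto_log_atTop.comp (tendsto_norm_atTop hA hθ hL)
  obtain ⟨b', hb', hab'⟩ :=
    ((hlog.eventually_ge_atTop (Real.log ‖θ a‖ + 1)).and (eventually_ge_atTop a)).exists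
  -- At `b` the logarithmic clock has advanced by exactly one since `a`.
  obtain ⟨b, ⟨hab, -⟩, hb⟩ := intermediate_value_Icc (f := fun t => Real.log ‖θ t‖) hab'
    (fun t ht => (hasDerivWithinAt_log_norm hθ hL (ha.trans ht.1)).continuousWithinAt.mono
      fun u hu => ha.trans hu.1) ⟨(by linarith : Real.log ‖θ a‖ ≤ Real.log ‖θ a‖ + 1), hb'⟩
  simp only at hb
  have hex : ∃ t, a ≤ t ∧ t ≤ b ∧ 2 * deviation A s (θ t) ^ 2 < ε ^ 2 / 2 := by
    by_contra! h
    have h1 := deviation_mul_le_logSoftMargin_sub hA hθ hL ha hab h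
    have h2 := hΓ a b haT' hab
    rw [hb] at h1
    linarith
  obtain ⟨t, hat, htb, hdev⟩ := hex
  refine ⟨t, haT.trans hat, ha.trans hat, ?_, ?_⟩
  · have h1 := norm_direction_sub_le hA hθ hL ha hat (half_pos hε)
    have h2 := hΓ a t haT' hat
    have h3 := log_norm_mono hθ hL (ha.trans hat) htb
    have h4 : ‖direction (θ a) - z‖ < ε / 2 := by simpa [dist_eq_norm] using haz
    have h5 := norm_sub_le_norm_sub_add_norm_sub (direction (θ t)) (direction (θ a)) z
    have h6 : (4 * (ε / 2))⁻¹ * (logSoftMargin A s (θ t) - logSoftMargin A s (θ a)) ≤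
        (4 * (ε / 2))⁻¹ * (ε ^ 2 / 2) := mul_le_mul_of_nonneg_left h2.le (by positivity)
    have h7 : (4 * (ε / 2))⁻¹ * (ε ^ 2 / 2) = ε / 4 := by field_simp
    have h8 : ε / 2 / 2 * (Real.log ‖θ t‖ - Real.log ‖θ a‖) ≤ ε / 2 / 2 * 1 :=
      mul_le_mul_of_nonneg_left (by linarith) (by positivity)
    linarith
  · nlinarith [sq_nonneg (deviation A s (θ t) - ε)]

end Flow

/-! ### Approximate multipliers and their limits. -/

/-- The approximate Lagrange multipliers of the direction of `θ`. -/
def multiplier (A : ι → E →L[ℝ] E) (s : ι → N) (θ : E) (p : ι) : ℝ :=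
  weight A s p θ * (‖θ‖ ^ 2 / alignment A s θ)

section Multiplier

variable {A : ι → E →L[ℝ] E} {s : ι → N} [Nonempty ι] {θ : E}

lemma multiplier_pos (hL : logisticLoss A s θ < Real.log 2) (p : ι) :
    0 < multiplier A s θ p :=
  mul_pos (weight_pos A s p θ) (div_pos (pow_pos (norm_pos_iff.2
    (ne_zero_of_logisticLoss_lt A s hL)) 2) (alignment_pos A s hL))

/-- The deviation is exactly the residual of the stationarity equation for these multipliers. -/
lemma norm_sum_multiplier_sub (hL : logisticLoss A s θ < Real.log 2) :
    ‖∑ p, multiplier A s θ p • A p (direction θ) - direction θ‖ = deviation A s θ := by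
  have h0 := norm_ne_zero_iff.2 (ne_zero_of_logisticLoss_lt A s hL)
  rw [deviation, descent, Finset.smul_sum]
  congr 2
  refine Finset.sum_congr rfl fun p _ => ?_
  rw [direction, map_smul, smul_smul, smul_smul, multiplier]
  congr 1
  field_simp

/-- Euler's identity fixes this normalization; with margins bounded below it bounds each multiplier.
-/
lemma sum_multiplier_mul_margin (hL : logisticLoss A s θ < Real.log 2) :
    2 * ∑ p, multiplier A s θ p * margin A p (direction θ) = 1 := by
  have h0 := norm_ne_zero_iff.2 (ne_zero_of_logisticLoss_lt A s hL)
  have hν := (alignment_pos A s hL).ne'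
  have h : ∑ p, multiplier A s θ p * margin A p (direction θ) =
      (∑ p, weight A s p θ * margin A p θ) / alignment A s θ := by
    rw [Finset.sum_div]
    refine Finset.sum_congr rfl fun p _ => ?_
    rw [margin_direction, multiplier]
    field_simp
  rw [h, ← mul_div_assoc, ← alignment_eq, div_self hν]

lemma exp_logSoftMargin_le (hL : logisticLoss A s θ < Real.log 2) (p : ι) :
    Real.exp (logSoftMargin A s θ) ≤ margin A p (direction θ) := by
  have h0 := norm_pos_iff.2 (ne_zero_of_logisticLoss_lt A s hL)
  have hG := softMargin_pos A s hL
  have h2 : 2 * Real.log ‖θ‖ = Real.log (‖θ‖ ^ 2) := by rw [Real.log_pow]; norm_num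
  rw [logSoftMargin, h2, Real.exp_sub, Real.exp_log hG, Real.exp_log (by positivity),
    margin_direction]
  exact div_le_div_of_nonneg_right (softMargin_le_margin A s p θ) (by positivity)

lemma multiplier_le (hL : logisticLoss A s θ < Real.log 2) {γ : ℝ} (hγ : 0 < γ)
    (h : ∀ p, γ ≤ margin A p (direction θ)) (p : ι) : multiplier A s θ p ≤ (2 * γ)⁻¹ := by
  have h1 := Finset.single_le_sum
    (f := fun p => multiplier A s θ p * margin A p (direction θ))
    (fun p _ => mul_nonneg (multiplier_pos hL p).le (hγ.le.trans (h p))) (Finset.mem_univ p)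
  have h2 := sum_multiplier_mul_margin hL
  have h3 := mul_le_mul_of_nonneg_left (h p) (multiplier_pos hL p).le
  rw [← one_div, le_div_iff₀ (by positivity)]
  linarith

/-- The softmax denominators lie between 1 and 2 since `expSum < 1`, which costs the factor 2 and
allows comparison across samples. -/
lemma multiplier_le_exp_mul (hL : logisticLoss A s θ < Real.log 2) (p p' : ι) :
    multiplier A s θ p ≤ 2 * multiplier A s θ p' *
      Real.exp (-(‖θ‖ ^ 2 * (margin A p (direction θ) - margin A p' (direction θ)))) := by
  have h0 := norm_pos_iff.2 (ne_zero_of_logisticLoss_lt A s hL)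
  have h1 : weight A s p θ ≤ Real.exp (-margin A p θ) :=
    div_le_self (Real.exp_pos _).le (by linarith [expSum_nonneg A s (s p) θ])
  have h2 : Real.exp (-margin A p' θ) ≤ 2 * weight A s p' θ := by
    have := expSum_lt_one A s hL (s p')
    have h3 := expSum_nonneg A s (s p') θ
    rw [weight, ← mul_div_assoc, le_div_iff₀ (by linarith), mul_comm]
    exact mul_le_mul_of_nonneg_right (by linarith) (Real.exp_pos _).le
  have h3 : ‖θ‖ ^ 2 * (margin A p (direction θ) - margin A p' (direction θ)) =
      margin A p θ - margin A p' θ := by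
    rw [margin_direction, margin_direction]
    field_simp
  have h4 : weight A s p θ ≤
      2 * weight A s p' θ * Real.exp (-(margin A p θ - margin A p' θ)) := by
    refine h1.trans (le_trans (le_of_eq ?_)
      (mul_le_mul_of_nonneg_right h2 (Real.exp_pos _).le))
    rw [← Real.exp_add]
    ring_nf
  rw [h3, multiplier, multiplier]
  have := mul_le_mul_of_nonneg_right h4
    (div_nonneg (sq_nonneg ‖θ‖) (alignment_pos A s hL).le)
  linarith

end Multiplier

/-- Every limit direction of the gradient flow of the logistic loss carries Lagrange multipliers
that are supported on the constraints of minimal margin. -/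
theorem exists_multipliers_of_mapClusterPt {A : ι → E →L[ℝ] E} {s : ι → N} [Nonempty ι]
    {θ : ℝ → E} {t₀ : ℝ} (hA : ∀ p x y, ⟪A p x, y⟫ = ⟪x, A p y⟫)
    (hθ : ∀ t, t₀ ≤ t → HasDerivWithinAt θ (descent A s (θ t)) (Ici t₀) t)
    (hloss : logisticLoss A s (θ t₀) < Real.log 2) {z : E}
    (hz : MapClusterPt z atTop fun t => direction (θ t)) :
    ∃ (c : ℝ) (μ : ι → ℝ), 0 < c ∧ (∀ p, c ≤ margin A p z) ∧ (∀ p, 0 ≤ μ p) ∧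
      ∑ p, μ p • A p z = z ∧ ∀ p, μ p * (margin A p z - c) = 0 := by
  have hL : ∀ t, t₀ ≤ t → logisticLoss A s (θ t) < Real.log 2 := fun t ht =>
    (logisticLoss_le hA hθ ht).trans_lt hloss
  have key : ∀ m : ℕ, ∃ t : ℝ, (m : ℝ) ≤ t ∧ t₀ ≤ t ∧
      ‖direction (θ t) - z‖ < 1 / ((m : ℝ) + 1) ∧ deviation A s (θ t) < 1 / ((m : ℝ) + 1) :=
    fun m => exists_direction_near_of_mapClusterPt hA hθ hL hz (by positivity) m
  choose t htm ht₀ htz htdev using key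
  -- Monotonicity of `logSoftMargin` makes its initial value a uniform lower bound for the
  -- normalized margins.
  set γ : ℝ := Real.exp (logSoftMargin A s (θ t₀))
  have hγ : 0 < γ := Real.exp_pos _
  have hmargin : ∀ m p, γ ≤ margin A p (direction (θ (t m))) := fun m p =>
    (Real.exp_le_exp.2 (logSoftMargin_mono hA hθ hL le_rfl (ht₀ m))).trans
      (exp_logSoftMargin_le (hL _ (ht₀ m)) p)
  have hmem : ∀ m, multiplier A s (θ (t m)) ∈ Icc (0 : ι → ℝ) fun _ => (2 * γ)⁻¹ := fun m =>
    ⟨fun p => (multiplier_pos (hL _ (ht₀ m)) p).le,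
      fun p => multiplier_le (hL _ (ht₀ m)) hγ (hmargin m) p⟩
  obtain ⟨μ, hμ, φ, hφ, hlim⟩ := isCompact_Icc.tendsto_subseq hmem
  have hlimp : ∀ p, Tendsto (fun m => multiplier A s (θ (t (φ m))) p) atTop (𝓝 (μ p)) :=
    fun p => (tendsto_pi_nhds.1 hlim) p
  have hx : Tendsto (fun m => direction (θ (t m))) atTop (𝓝 z) := by
    rw [tendsto_iff_norm_sub_tendsto_zero]
    exact squeeze_zero (fun _ => norm_nonneg _) (fun m => (htz m).le)
      tendsto_one_div_add_atTop_nhds_zero_nat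
  have hxφ := hx.comp hφ.tendsto_atTop
  have hdev : Tendsto (fun m => deviation A s (θ (t m))) atTop (𝓝 0) :=
    squeeze_zero (fun _ => norm_nonneg _) (fun m => (htdev m).le)
      tendsto_one_div_add_atTop_nhds_zero_nat
  have hmlim : ∀ p, Tendsto (fun m => margin A p (direction (θ (t (φ m))))) atTop
      (𝓝 (margin A p z)) := fun p => ((continuous_margin A p).tendsto z).comp hxφ
  obtain ⟨p₀, hp₀⟩ := Finite.exists_min fun p => margin A p z
  have hnorm : Tendsto (fun m => ‖θ (t (φ m))‖) atTop atTop :=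
    (tendsto_norm_atTop hA hθ hL).comp ((tendsto_atTop_mono htm
      tendsto_natCast_atTop_atTop).comp hφ.tendsto_atTop)
  refine ⟨margin A p₀ z, μ, hγ.trans_le (ge_of_tendsto' (hmlim p₀) fun m => hmargin _ _), hp₀,
    hμ.1, ?_, fun p => ?_⟩
  · have h1 : Tendsto (fun m => ∑ p, multiplier A s (θ (t (φ m))) p •
        A p (direction (θ (t (φ m)))) - direction (θ (t (φ m)))) atTop
        (𝓝 (∑ p, μ p • A p z - z)) :=
      (tendsto_finsetSum _ fun p _ =>
        (hlimp p).smul (((A p).continuous.tendsto z).comp hxφ)).sub hxφ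
    have h2 : Tendsto (fun m => ‖∑ p, multiplier A s (θ (t (φ m))) p •
        A p (direction (θ (t (φ m)))) - direction (θ (t (φ m)))‖) atTop (𝓝 0) :=
      (hdev.comp hφ.tendsto_atTop).congr fun m =>
        (norm_sum_multiplier_sub (hL _ (ht₀ (φ m)))).symm
    exact sub_eq_zero.1 (norm_eq_zero.1 (tendsto_nhds_unique h1.norm h2))
  · rcases (hp₀ p).eq_or_lt with h | h
    · rw [h, sub_self, mul_zero]
    -- The gap to the minimal margin is positive in the limit and is multiplied by `‖θ‖² → ∞`, so
    -- the exponential kills this multiplier.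
    · have hexp : Tendsto (fun m => 2 * multiplier A s (θ (t (φ m))) p₀ *
          Real.exp (-(‖θ (t (φ m))‖ ^ 2 * (margin A p (direction (θ (t (φ m)))) -
            margin A p₀ (direction (θ (t (φ m)))))))) atTop (𝓝 (2 * μ p₀ * 0)) :=
        ((hlimp p₀).const_mul 2).mul (Real.tendsto_exp_neg_atTop_nhds_zero.comp
          (((tendsto_pow_atTop two_ne_zero).comp hnorm).atTop_mul_pos (sub_pos.2 h)
            ((hmlim p).sub (hmlim p₀))))
      have hle := le_of_tendsto_of_tendsto' (hlimp p) hexp fun m =>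
        multiplier_le_exp_mul (hL _ (ht₀ (φ m))) p p₀
      rw [mul_zero] at hle
      rw [le_antisymm hle (hμ.1 p), zero_mul]

end QuadraticMargin

/-! ### The layer-peeled model as an instance. -/

namespace ULPM

open scoped RealInnerProductSpace
open QuadraticMargin

variable {K n d : ℕ}

/-- The symmetric operator of the quadratic form `2 * logit`. -/
def logitOp (j k : Fin K) (i : Fin n) : Params K n d →L[ℝ] Params K n d :=
  ∑ a : Fin d,
    ((EuclideanSpace.proj (Sum.inr (a, (k, i)))).smulRight
        (EuclideanSpace.single (Sum.inl (j, a)) (1 : ℝ)) +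
      (EuclideanSpace.proj (Sum.inl (j, a))).smulRight
        (EuclideanSpace.single (Sum.inr (a, (k, i))) (1 : ℝ)))

lemma inner_logitOp (j k : Fin K) (i : Fin n) (x y : Params K n d) :
    ⟪logitOp j k i x, y⟫ = ∑ a : Fin d, (x (Sum.inr (a, (k, i))) * y (Sum.inl (j, a)) +
      x (Sum.inl (j, a)) * y (Sum.inr (a, (k, i)))) := by
  simp [logitOp, sum_inner, inner_add_left, inner_smul_left, EuclideanSpace.inner_single_left]

/-- The symmetric operator of the quadratic form of twice the margin indexed by `p`. -/
def marginOp (p : SepIndex K n) : Params K n d →L[ℝ] Params K n d :=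
  logitOp p.1.1 p.1.1 p.1.2.2 - logitOp p.1.2.1 p.1.1 p.1.2.2

lemma inner_marginOp_comm (p : SepIndex K n) (x y : Params K n d) :
    ⟪marginOp p x, y⟫ = ⟪x, marginOp p y⟫ := by
  rw [real_inner_comm (marginOp p y) x]
  simp only [marginOp, sub_apply, inner_sub_left, inner_logitOp]
  congr 1 <;> exact Finset.sum_congr rfl fun a _ => by ring

lemma margin_marginOp (p : SepIndex K n) (θ : Params K n d) :
    margin marginOp p θ =
      logit θ p.1.1 p.1.1 p.1.2.2 - logit θ p.1.2.1 p.1.1 p.1.2.2 := by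
  simp only [margin, marginOp, sub_apply, inner_sub_left, inner_logitOp, logit,
    dotProduct, Matrix.row, Matrix.col, W, H, Matrix.of_apply, Matrix.transpose_apply, mul_sub,
    Finset.mul_sum]
  congr 1 <;> exact Finset.sum_congr rfl fun a _ => by ring

/-- The sample to which a separation constraint belongs. -/
def sample (p : SepIndex K n) : Fin K × Fin n := (p.1.1, p.1.2.2)

/-- The summand 1 is the term `j = k`; the other labels correspond to the constraints of the sample.
-/
lemma one_add_expSum_marginOp (k : Fin K) (i : Fin n) (θ : Params K n d) :
    1 + expSum marginOp sample (k, i) θ =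
      ∑ j : Fin K, Real.exp (logit θ j k i - logit θ k k i) := by
  rw [← Finset.add_sum_erase _ _ (Finset.mem_univ k), sub_self, Real.exp_zero, expSum]
  congr 1
  refine Finset.sum_bij (fun p _ => p.1.2.1) ?_ ?_ ?_ ?_
  · rintro ⟨⟨k', j, i'⟩, hne⟩ hp
    obtain ⟨rfl, rfl⟩ : k' = k ∧ i' = i := by simpa [sample] using hp
    simpa using hne.symm
  · rintro ⟨⟨k₁, j₁, i₁⟩, h₁⟩ hp₁ ⟨⟨k₂, j₂, i₂⟩, h₂⟩ hp₂ h
    simp only [sample, Finset.mem_filter, Finset.mem_univ, true_and, Prod.mk.injEq] at hp₁ hp₂ h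
    simp [hp₁, hp₂, h]
  · intro j hj
    exact ⟨⟨(k, j, i), (Finset.ne_of_mem_erase hj).symm⟩, by simp [sample], rfl⟩
  · rintro ⟨⟨k', j, i'⟩, hne⟩ hp
    obtain ⟨rfl, rfl⟩ : k' = k ∧ i' = i := by simpa [sample] using hp
    rw [margin_marginOp, neg_sub]

lemma loss_eq_logisticLoss (θ : Params K n d) :
    loss θ = logisticLoss marginOp sample θ := by
  rw [loss, logisticLoss, Fintype.sum_prod_type, ← Finset.sum_neg_distrib]
  refine Finset.sum_congr rfl fun k _ => ?_
  rw [← Finset.sum_neg_distrib]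
  refine Finset.sum_congr rfl fun i _ => ?_
  rw [one_add_expSum_marginOp, ← Real.log_inv, inv_div, Finset.sum_div]
  simp only [Real.exp_sub]

lemma gradient_loss (θ : Params K n d) :
    ∇ (loss (K := K) (n := n) (d := d)) θ = -descent marginOp sample θ := by
  have h : loss (K := K) (n := n) (d := d) = logisticLoss marginOp sample :=
    funext loss_eq_logisticLoss
  rw [h]
  exact (hasGradientAt_iff_hasFDerivAt.2
    (hasFDerivAt_logisticLoss sample inner_marginOp_comm θ)).gradient

lemma gradient_sepConstraint (p : SepIndex K n) (θ : Params K n d) :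
    ∇ (sepConstraint (d := d) p) θ = -marginOp p θ := by
  have h : sepConstraint (d := d) p = fun θ => 1 - margin marginOp p θ :=
    funext fun θ => by rw [sepConstraint, margin_marginOp]
  rw [h]
  refine (hasGradientAt_iff_hasFDerivAt.2 ?_).gradient
  refine ((hasFDerivAt_margin inner_marginOp_comm p θ).const_sub 1).congr_fderiv ?_
  ext x
  simp

lemma frobSq_add_frobSq (θ : Params K n d) : frobSq (W θ) + frobSq (H θ) = ‖θ‖ ^ 2 := by
  rw [EuclideanSpace.norm_sq_eq, Fintype.sum_sum_type]
  simp only [frobSq, W, H, Matrix.of_apply, Fintype.sum_prod_type, Real.norm_eq_abs, sq_abs]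

lemma gradient_sepObjective (θ : Params K n d) :
    ∇ (sepObjective (K := K) (n := n) (d := d)) θ = θ := by
  have h : sepObjective (K := K) (n := n) (d := d) = fun θ => 1 / 2 * ‖θ‖ ^ 2 :=
    funext fun θ => by rw [sepObjective, ← mul_add, frobSq_add_frobSq]
  rw [h]
  refine (hasGradientAt_iff_hasFDerivAt.2 ?_).gradient
  refine ((hasStrictFDerivAt_norm_sq θ).hasFDerivAt.const_mul (1 / 2 : ℝ)).congr_fderiv ?_
  ext x
  simp

lemma normalized_eq_direction (θ : Params K n d) : normalized θ = direction θ := by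
  rw [normalized, frobSq_add_frobSq, Real.sqrt_sq (norm_nonneg _), direction]

end ULPM

end

theorem mainTheorem2 (K n d : ℕ) (hK : 2 ≤ K) (hn : 1 ≤ n)
    (θ : ℝ → ULPM.Params K n d) (hθ : ULPM.IsGradientFlow θ)
    (t₀ : ℝ) (ht₀ : 0 ≤ t₀) (hloss : ULPM.loss (θ t₀) < Real.log 2)
    (p : ULPM.Params K n d)
    (hp : MapClusterPt p atTop (fun t : ℝ => ULPM.normalized (θ t))) :
    ∃ (c : ℝ) (x : ULPM.Params K n d), 0 < c ∧ ULPM.IsSepKKTPoint x ∧ p = c • x := by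
  have : Nonempty (ULPM.SepIndex K n) :=
    ⟨⟨(⟨0, by omega⟩, ⟨1, by omega⟩, ⟨0, by omega⟩), by simp⟩⟩
  have hflow : ∀ t, t₀ ≤ t → HasDerivWithinAt θ
      (QuadraticMargin.descent ULPM.marginOp ULPM.sample (θ t)) (Ici t₀) t := by
    intro t ht
    have h := (hθ t (ht₀.trans ht)).mono (Ici_subset_Ici.2 ht₀)
    rwa [ULPM.gradient_loss, neg_neg] at h
  rw [ULPM.loss_eq_logisticLoss] at hloss
  simp only [ULPM.normalized_eq_direction] at hp
  obtain ⟨c, μ, hc, hfeas, hμ, hsum, hslack⟩ :=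
    QuadraticMargin.exists_multipliers_of_mapClusterPt ULPM.inner_marginOp_comm hflow hloss hp
  have hsqrt : 0 < √c := Real.sqrt_pos.2 hc
  have hcon : ∀ q, ULPM.sepConstraint q ((√c)⁻¹ • p) =
      1 - c⁻¹ * QuadraticMargin.margin ULPM.marginOp q p := by
    intro q
    rw [ULPM.sepConstraint, ← ULPM.margin_marginOp, QuadraticMargin.margin_smul, inv_pow,
      Real.sq_sqrt hc.le]
  -- By 2-homogeneity, dividing by `√c` makes the minimal margin one; stationarity is linear in the
  -- point, so the multipliers stay the same.
  refine ⟨√c, (√c)⁻¹ • p, hsqrt, ⟨fun q => ?_, μ, hμ, ?_, fun q => ?_⟩, ?_⟩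
  · rw [hcon, sub_nonpos, ← div_eq_inv_mul, one_le_div₀ hc]
    exact hfeas q
  · simp only [ULPM.gradient_sepObjective, ULPM.gradient_sepConstraint, map_smul, smul_neg,
      Finset.sum_neg_distrib, smul_comm _ (√c)⁻¹, ← Finset.smul_sum, hsum, add_neg_cancel]
  · rw [hcon]
    have h := hslack q
    field_simp
    linarith
  · rw [smul_inv_smul₀ hsqrt.ne']
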